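/- **Setting.** Let $T$ be an endofunctor on the category of sets and $\Lambda$ a set of (unary) modal operators, each $\heartsuit\in\Lambda$ interpreted by a monotone predicate lifting, i.e. a family of maps $[\![\heartsuit]\!]_X:\mathcal P(X)\to\mathcal P(TX)$ that are monotone and satisfy $[\![\heartsuit]\!]_X(f^{-1}[A])=(Tf)^{-1}[[\![\heartsuit]\!]_Y(A)]$ for all $f:X\to Y$ and $A\subseteq Y$; write $t\models\heartsuit A$ for $t\in[\![\heartsuit]\!]_X(A)$. Positive $\Lambda$-formulas are given by $\phi,\psi::=\top\mid\bot\mid\phi\wedge\psi\mid\phi\vee\psi\mid\heartsuit\phi$; conjunctive formulas are those without $\bot,\vee$. In a $T$-coalgebra $(X,\xi:X\to TX)$, $x\models\heartsuit\phi$ iff $\xi(x)\models\heartsuit[\![\phi]\!]$, where $[\![\phi]\!]\subseteq X$ is the set of states that satisfy $\phi$. Subsumption $\phi\sqsubseteq\psi$ means $[\![\phi]\!]\subseteq[\![\psi]\!]$ in every $T$-coalgebra. Operators are written as finite strings (or trees) via a fixed injective encoding, and formulas etc. are encoded accordingly. **One-step logic.** A conjunctive one-step formula over a set $V$ of variables is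 a finite conjunction $\bigwedge_i\heartsuit_ip_i$ with $\heartsuit_i\in\Lambda$, $p_i\in V$. A one-step model is $(X,\tau,t)$ with $X$ a set, $\tau:V\to\mathcal P(X)$, $t\in TX$; it satisfies $\bigwedge_i\heartsuit_ip_i$ iff $t\models\heartsuit_i\tau(p_i)$ for all $i$. Put $\breve\tau(x)=\{p: x\in\tau(p)\}$. Let $\mathsf{Pos}(V)$ be the set of positive propositional combinations ($\top,\bot,\wedge,\vee$) over $V$. For $\rho\in\mathsf{Pos}(V)$, $\psi\sqsubseteq_1\heartsuit\rho$ means that $t\models\heartsuit[\![\rho]\!]_\tau$ for every one-step model $(X,\tau,t)$ of $\psi$. The *conjunctive one-step consequence problem* of $\Lambda$ is to decide, given $\psi,\heartsuit,\rho$, whether $\psi\sqsubseteq_1\heartsuit\rho$. A one-step model $(X,\tau,t)$ is *wsi* (weakly simulation-initial) for $\psi$ if it satisfies $\psi$ and, for every one-step model $(Y,\theta,s)$ of $\psi$, every $A\subseteq X$ and every $\heartsuit\in\Lambda$, $t\models\heartsuit A$ implies $s\models\heartsuit\{y:\exists x\in A,\ \breve\tau(x)\subseteq\breve\theta(y)\}$.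 **Abstract wsi models.** An abstract wsi model for a conjunctive formula $\phi$ is a finite pointed graph (tree, dag, or with cycles) in which every state $s$ carries a conjunctive one-step formula $\phi^*_s$ over a finite set $V_s$ of variables (exactly those that occur in it), a finite set $X_s$, a valuation $\tau_s:V_s\to\mathcal P(X_s)$, and a map attaching each $x\in X_s$ to a state, such that * for every $s$ there is $t\in TX_s$ (not stored) such that $(X_s,\tau_s,t)$ is wsi for $\phi^*_s$; * there are substitutions $\rho_s$, injective on $V_s$, of conjunctive formulas for variables such that $\phi^*_r\rho_r$ is $\phi$ for the root $r$, and whenever $x\in X_s$ is attached to $s'$, $\phi^*_{s'}\rho_{s'}$ is $\bigwedge_{p\in\breve\tau_s(x)}\rho_s(p)$, where outermost conjunctions are read as finite sets of formulas $\heartsuit\chi$. A set $\mathcal L$ of conjunctive $\Lambda$-formulas *admits polynomial wsi models* if there is a polynomial-time algorithm that computes, for every $\phi\in\mathcal L$, an abstract wsi model for $\phi$. **Lemma.** Let $\mathcal L$ be a set of conjunctive $\Lambda$-formulas that admits polynomial wsi models, and suppose that the conjunctive one-step consequence problem of $\Lambda$ is in P. Then the problem of deciding, given $\phi\in\mathcal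 L$ and a positive $\Lambda$-formula $\psi$, whether $\phi\sqsubseteq\psi$, is in P. -/

import Mathlib

universe u v

namespace CoalgLogic

/-! ### Polynomial time

The machine model is a deterministic while-language over binary trees (S-expressions).  Running
time is charged by size: executing any node of a program costs the size of the tree it reads plus
the size of the tree it produces, on top of the cost of its parts.  Hence every unit of cost is a
constant amount of work of a Turing machine up to a polynomial, a Turing machine can be simulated
with polynomial overhead, and outputs of polynomial-time programs have polynomial size. -/

/-- Binary trees, the inputs and outputs of programs. -/
inductive Data : Type
  | nil : Data
  | cons : Data → Data → Data

namespace Data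

/-- The number of nodes of a tree. -/
def size : Data → ℕ
  | nil => 1
  | cons a b => size a + size b + 1

/-- Left component, with `nil` sent to `nil`. -/
def hd : Data → Data
  | nil => nil
  | cons a _ => a

/-- Right component, with `nil` sent to `nil`. -/
def tl : Data → Data
  | nil => nil
  | cons _ b => b

end Data

/-- Programs; each one transforms a tree into a tree.  The value `nil` counts as false in tests. -/
inductive Prog : Type
  | id : Prog
  | nil : Prog
  | hd : Prog
  | tl : Prog
  /-- run both programs on the same input and pair the results -/
  | pair : Prog → Prog → Prog
  /-- `comp g f` runs `f` first and `g` on its result -/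
  | comp : Prog → Prog → Prog
  /-- `ite c f g` runs `f` if the test `c` returns a non-`nil` value, and `g` otherwise -/
  | ite : Prog → Prog → Prog → Prog
  /-- `loop c f` repeatedly replaces the current value by its image under `f` as long as the
  test `c` returns a non-`nil` value on it -/
  | loop : Prog → Prog → Prog

/-- The cost of executing one node of a program, apart from the cost of its parts. -/
def nodeCost (input output : Data) : ℕ := input.size + output.size

/-- `Run p d e n`: on input `d` the program `p` halts with output `e`, at total cost `n`. -/
inductive Run : Prog → Data → Data → ℕ → Prop
  | id (d : Data) : Run Prog.id d d (nodeCost d d)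
  | nil (d : Data) : Run Prog.nil d Data.nil (nodeCost d Data.nil)
  | hd (d : Data) : Run Prog.hd d d.hd (nodeCost d d.hd)
  | tl (d : Data) : Run Prog.tl d d.tl (nodeCost d d.tl)
  | pair {f g : Prog} {d a b : Data} {m n : ℕ} :
      Run f d a m → Run g d b n →
        Run (Prog.pair f g) d (Data.cons a b) (m + n + nodeCost d (Data.cons a b))
  | comp {f g : Prog} {d a b : Data} {m n : ℕ} :
      Run f d a m → Run g a b n → Run (Prog.comp g f) d b (m + n + nodeCost d b)
  | iteTrue {c f g : Prog} {d b e : Data} {m n : ℕ} :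
      Run c d b m → b ≠ Data.nil → Run f d e n →
        Run (Prog.ite c f g) d e (m + n + nodeCost d e)
  | iteFalse {c f g : Prog} {d e : Data} {m n : ℕ} :
      Run c d Data.nil m → Run g d e n →
        Run (Prog.ite c f g) d e (m + n + nodeCost d e)
  | loopStop {c f : Prog} {d : Data} {m : ℕ} :
      Run c d Data.nil m → Run (Prog.loop c f) d d (m + nodeCost d d)
  | loopStep {c f : Prog} {d b a e : Data} {m n k : ℕ} :
      Run c d b m → b ≠ Data.nil → Run f d a n → Run (Prog.loop c f) a e k →
        Run (Prog.loop c f) d e (m + n + k + nodeCost d e)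

/-- The function `f`, between types whose elements are written as trees via `encα` and `encβ`,
is computable in polynomial time. -/
def PolyTimeComputable {α : Type*} {β : Type*} (encα : α → Data) (encβ : β → Data)
    (f : α → β) : Prop :=
  ∃ (p : Prog) (q : Polynomial ℕ), ∀ a : α,
    ∃ n : ℕ, n ≤ q.eval (encα a).size ∧ Run p (encα a) (encβ (f a)) n

/-- Encoding of truth values. -/
def encBool : Bool → Data
  | false => Data.nil
  | true => Data.cons Data.nil Data.nil

/-- The decision problem with set of instances `α` (written as trees via `enc`) and set of
yes-instances `P` is in P. -/
def InP {α : Type*} (enc : α → Data) (P : α → Prop) : Prop :=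
  ∃ χ : α → Bool, (∀ a, χ a = true ↔ P a) ∧ PolyTimeComputable enc encBool χ

/-- Encoding of lists. -/
def encList {α : Type*} (enc : α → Data) : List α → Data
  | [] => Data.nil
  | a :: l => Data.cons (enc a) (encList enc l)

/-- Unary encoding of natural numbers. -/
def encUnary : ℕ → Data
  | 0 => Data.nil
  | n + 1 => Data.cons Data.nil (encUnary n)

/-- Binary encoding of natural numbers. -/
def encNat (n : ℕ) : Data := encList encBool n.bits

/-! ### Syntax and semantics of coalgebraic modal logic -/

/-- Positive `Λ`-formulas. -/
inductive Formula (Λ : Type v) : Type v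
  | top : Formula Λ
  | bot : Formula Λ
  | and : Formula Λ → Formula Λ → Formula Λ
  | or : Formula Λ → Formula Λ → Formula Λ
  | mod : Λ → Formula Λ → Formula Λ

/-- Conjunctive formulas: those built without `⊥` and `∨`. -/
def Formula.IsConjunctive {Λ : Type v} : Formula Λ → Prop
  | .top => True
  | .bot => False
  | .and φ ψ => φ.IsConjunctive ∧ ψ.IsConjunctive
  | .or _ _ => False
  | .mod _ φ => φ.IsConjunctive

/-- An interpretation of the modal operators in `Λ` over the endofunctor `T` of the category of
sets: each operator is interpreted by a monotone predicate lifting. -/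
structure Interpretation (T : Type u → Type u) [Functor T] (Λ : Type v) where
  lift : Λ → ∀ X : Type u, Set X → Set (T X)
  natural : ∀ (h : Λ) {X Y : Type u} (f : X → Y) (A : Set Y),
    lift h X (f ⁻¹' A) = (fun t : T X => f <$> t) ⁻¹' lift h Y A
  mono : ∀ (h : Λ) (X : Type u) (A B : Set X), A ⊆ B → lift h X A ⊆ lift h X B

section Semantics

variable {T : Type u → Type u} [Functor T] {Λ : Type v}

/-- The extension of a formula in the `T`-coalgebra `(X, ξ)`. -/
def extension (I : Interpretation T Λ) {X : Type u} (ξ : X → T X) : Formula Λ → Set X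
  | .top => Set.univ
  | .bot => ∅
  | .and φ ψ => extension I ξ φ ∩ extension I ξ ψ
  | .or φ ψ => extension I ξ φ ∪ extension I ξ ψ
  | .mod h φ => {x | ξ x ∈ I.lift h X (extension I ξ φ)}

/-- Subsumption `φ ⊑ ψ`: in every `T`-coalgebra the extension of `φ` is contained in that
of `ψ`. -/
def Subsumes (I : Interpretation T Λ) (φ ψ : Formula Λ) : Prop :=
  ∀ (X : Type u) (ξ : X → T X), extension I ξ φ ⊆ extension I ξ ψ

end Semantics

/-! ### One-step logic -/

/-- `Pos(V)`: positive propositional combinations of variables. -/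
inductive PosProp (V : Type*)
  | var : V → PosProp V
  | top : PosProp V
  | bot : PosProp V
  | and : PosProp V → PosProp V → PosProp V
  | or : PosProp V → PosProp V → PosProp V

/-- The extension of a positive propositional combination under a valuation. -/
def PosProp.extension {V : Type*} {X : Type u} (τ : V → Set X) : PosProp V → Set X
  | .var p => τ p
  | .top => Set.univ
  | .bot => ∅
  | .and ρ σ => ρ.extension τ ∩ σ.extension τ
  | .or ρ σ => ρ.extension τ ∪ σ.extension τ

/-- Conjunctive one-step `Λ`-formulas over `V`: finite conjunctions of atoms `♥ p`. -/
abbrev OneStepConj (Λ : Type v) (V : Type*) := List (Λ × V)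

section OneStep

variable {T : Type u → Type u} [Functor T] {Λ : Type v} {V : Type*}

/-- Satisfaction of a conjunctive one-step formula in the one-step model `(X, τ, t)`. -/
def OneStepSat (I : Interpretation T Λ) {X : Type u} (τ : V → Set X) (t : T X)
    (φ : OneStepConj Λ V) : Prop :=
  ∀ a ∈ φ, t ∈ I.lift a.1 X (τ a.2)

/-- One-step subsumption `ψ ⊑₁ ♥ρ`. -/
def OneStepConsequence (I : Interpretation T Λ) (ψ : OneStepConj Λ V) (h : Λ)
    (ρ : PosProp V) : Prop :=
  ∀ (X : Type u) (τ : V → Set X) (t : T X),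
    OneStepSat I τ t ψ → t ∈ I.lift h X (ρ.extension τ)

/-- The one-step model `(X, τ, t)` is weakly simulation-initial for `φ`: it satisfies `φ`, and for
every one-step model `(Y, θ, s)` of `φ`, `t ∈ ♥A` implies `s ∈ ♥S[A]`, where `x S y` iff every
variable true at `x` under `τ` is true at `y` under `θ`. -/
def IsOneStepWsi (I : Interpretation T Λ) (φ : OneStepConj Λ V) {X : Type u} (τ : V → Set X)
    (t : T X) : Prop :=
  OneStepSat I τ t φ ∧
    ∀ (Y : Type u) (θ : V → Set Y) (s : T Y), OneStepSat I θ s φ →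
      ∀ (h : Λ) (A : Set X), t ∈ I.lift h X A →
        s ∈ I.lift h Y {y | ∃ x ∈ A, ∀ p, x ∈ τ p → y ∈ θ p}

end OneStep

/-! ### Abstract wsi models -/

/-- The information stored at one state of an abstract wsi model with `n` states: a conjunctive
one-step formula together with a finite one-step model `(X, τ, t)` without the component `t`,
whose elements are attached to states.  The entry of the list `succ` at position `x` records, for
the `x`-th element of `X`, the state to which it is attached and the set (as a list) of the
variables that hold at it. -/
structure AbstractNode (Λ : Type v) (n : ℕ) where
  form : OneStepConj Λ ℕ
  succ : List (Fin n × List ℕ)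

/-- The carrier `X` of the one-step model stored at a state. -/
abbrev AbstractNode.Carrier {Λ : Type v} {n : ℕ} (N : AbstractNode Λ n) : Type u :=
  ULift.{u} (Fin N.succ.length)

/-- The valuation `τ` of the one-step model stored at a state. -/
def AbstractNode.valuation {Λ : Type v} {n : ℕ} (N : AbstractNode Λ n) (p : ℕ) :
    Set (AbstractNode.Carrier.{u} N) :=
  {x | p ∈ (N.succ.get x.down).2}

/-- Finite pointed graphs labelled with one-step formulas and valuations. -/
structure AbstractModel (Λ : Type v) where
  card : ℕ
  node : Fin card → AbstractNode Λ card
  root : Fin card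

/-- The set of pairs `(♥ᵢ, χᵢ)` when the (conjunctive) formula is read as `⋀ ♥ᵢ χᵢ`. -/
def Formula.conjuncts {Λ : Type v} : Formula Λ → Set (Λ × Formula Λ)
  | .top => ∅
  | .bot => ∅
  | .and φ ψ => φ.conjuncts ∪ ψ.conjuncts
  | .or _ _ => ∅
  | .mod h φ => {(h, φ)}

/-- The conjuncts of the formula `φ*ρ` obtained from a conjunctive one-step formula `φ*` by
substituting formulas for variables. -/
def substConjuncts {Λ : Type v} (φ : OneStepConj Λ ℕ) (ρ : ℕ → Formula Λ) :
    Set (Λ × Formula Λ) :=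
  {c | ∃ a ∈ φ, c = (a.1, ρ a.2)}

/-- `A` is an abstract wsi model for the conjunctive formula `φ`.  For a substitution `ρ s` at
every state `s`, the state `s` realizes the formula `φ*ρ` where `φ*` is the one-step formula stored
at `s`; the root realizes `φ`; the one-step model stored at `s` becomes a one-step wsi model of
`φ*` for some `t`; and an element `x` of it is attached to a state that realizes the conjunction of
all `ρ(p)` with `p` true at `x`.  Formulas are read as finite sets of conjuncts. -/
structure IsAbstractWsi {T : Type u → Type u} [Functor T] {Λ : Type v}
    (I : Interpretation T Λ) (A : AbstractModel Λ) (φ : Formula Λ) : Prop where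
  vars : ∀ s, ∀ x ∈ (A.node s).succ, ∀ p ∈ x.2, ∃ a ∈ (A.node s).form, a.2 = p
  wsi : ∀ s, ∃ t : T (AbstractNode.Carrier.{u} (A.node s)),
    IsOneStepWsi I (A.node s).form (A.node s).valuation t
  subst : ∃ ρ : Fin A.card → ℕ → Formula Λ,
    (∀ s p, (ρ s p).IsConjunctive) ∧
    (∀ s, Set.InjOn (ρ s) {p | ∃ a ∈ (A.node s).form, a.2 = p}) ∧
    substConjuncts (A.node A.root).form (ρ A.root) = φ.conjuncts ∧
    ∀ s, ∀ x ∈ (A.node s).succ,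
      substConjuncts (A.node x.1).form (ρ x.1) = ⋃ p ∈ x.2, (ρ s p).conjuncts

/-! ### Encodings and the decision problems

All encodings are relative to an encoding `code` of the modal operators. -/

section Encodings

variable {Λ : Type v}

/-- Encoding of positive formulas. -/
def encFormula (code : Λ → Data) : Formula Λ → Data
  | .top => Data.cons (encUnary 0) Data.nil
  | .bot => Data.cons (encUnary 1) Data.nil
  | .and φ ψ => Data.cons (encUnary 2) (Data.cons (encFormula code φ) (encFormula code ψ))
  | .or φ ψ => Data.cons (encUnary 3) (Data.cons (encFormula code φ) (encFormula code ψ))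
  | .mod h φ => Data.cons (encUnary 4) (Data.cons (code h) (encFormula code φ))

/-- Encoding of positive propositional combinations of variables. -/
def encPosProp : PosProp ℕ → Data
  | .top => Data.cons (encUnary 0) Data.nil
  | .bot => Data.cons (encUnary 1) Data.nil
  | .and ρ σ => Data.cons (encUnary 2) (Data.cons (encPosProp ρ) (encPosProp σ))
  | .or ρ σ => Data.cons (encUnary 3) (Data.cons (encPosProp ρ) (encPosProp σ))
  | .var p => Data.cons (encUnary 4) (encNat p)

/-- Encoding of conjunctive one-step formulas. -/
def encOneStepConj (code : Λ → Data) : OneStepConj Λ ℕ → Data :=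
  encList fun a => Data.cons (code a.1) (encNat a.2)

/-- Encoding of a state of an abstract wsi model.  References to states are in unary; this is
harmless since the states are all listed. -/
def encNode (code : Λ → Data) {n : ℕ} (N : AbstractNode Λ n) : Data :=
  Data.cons (encOneStepConj code N.form)
    (encList (fun x => Data.cons (encUnary x.1) (encList encNat x.2)) N.succ)

/-- Encoding of abstract wsi models. -/
def encModel (code : Λ → Data) (A : AbstractModel Λ) : Data :=
  Data.cons (encUnary A.root) (encList (encNode code) (List.ofFn A.node))

variable {T : Type u → Type u} [Functor T]

/-- The conjunctive one-step consequence problem is in P: given `ψ`, `♥`, `ρ`, decide whether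
`ψ ⊑₁ ♥ρ`. -/
def OneStepConsequenceInP (I : Interpretation T Λ) (code : Λ → Data) : Prop :=
  InP
    (fun i : OneStepConj Λ ℕ × Λ × PosProp ℕ =>
      Data.cons (encOneStepConj code i.1) (Data.cons (code i.2.1) (encPosProp i.2.2)))
    (fun i => OneStepConsequence I i.1 i.2.1 i.2.2)

/-- The set `L` of formulas admits polynomial wsi models: there is a polynomial-time algorithm
that computes an abstract wsi model for every formula in `L`. -/
def AdmitsPolynomialWsiModels (I : Interpretation T Λ) (code : Λ → Data)
    (L : Set (Formula Λ)) : Prop :=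
  ∃ F : L → AbstractModel Λ, (∀ φ : L, IsAbstractWsi I (F φ) φ) ∧
    PolyTimeComputable (fun φ : L => encFormula code φ) (encModel code) F

/-- Subsumption `φ ⊑ ψ` between formulas `φ` in `L` and arbitrary positive formulas `ψ` is
in P. -/
def SubsumptionInP (I : Interpretation T Λ) (code : Λ → Data) (L : Set (Formula Λ)) : Prop :=
  InP
    (fun i : L × Formula Λ => Data.cons (encFormula code i.1) (encFormula code i.2))
    (fun i => Subsumes I i.1 i.2)

end Encodings

end CoalgLogic

/-!
The theorem reduces `φ ⊑ ψ` to model checking `ψ` at the root of an abstract wsi model `A` of `φ`,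
and model checking to the conjunctive one-step consequence problem.

*Semantics.*  Choosing the missing components `t s ∈ T X_s` and pushing them forward along the
attachment maps turns the states of `A` into a coalgebra (`AbstractModel.coalg`).  Each state
satisfies the formula that it realizes (`Realization.mem_extension_of_conjuncts_subset`), and,
the one-step models being wsi, every positive formula true at a state `s` holds at each
state of each coalgebra that satisfies the formula realized by `s`
(`Realization.mem_extension_of_forall_theory`).  Hence `φ ⊑ ψ` iff the root satisfies `ψ`
(`Realization.subsumes_iff`).  The extension of `♥χ` is determined by that of `χ` without knowledge
of `t`: if `B` is the set of all `x ∈ X_s` attached to states satisfying `χ`, then `s` satisfies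
`♥χ` iff `♥ ⋁_{x ∈ B} ⋀ {p | x ∈ τ_s(p)}` is a one-step consequence of the formula stored at `s`
(`Realization.mem_extension_mod_iff`).  One direction is the wsi property; the other evaluates the
consequence in the stored one-step model itself, where the disjunction has extension `B` because
`B` is closed under adding variables.

*Complexity.*  So the truth vectors (one truth value per state) of the subformulas of `ψ` can be
computed bottom-up, with one call of the consequence procedure per state and modal subformula.
Polynomial time is established with a small calculus: `PolyTime e g` says that a program takes
`e a` to `g a` in polynomial time uniformly in an index `a`.  It is closed under composition,
pairing, case distinction and, if the number of steps and all sizes are polynomially bounded, loops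
(`PolyTime.loop`); a left fold runs in polynomial time if every step adds to the accumulator an
amount independent of the accumulator (`PolyTime.foldl`).  Recursion over `ψ` is a loop that lists
its subformulas (`PolyTime.reverse_subs`) followed by a fold over this list that
maintains a stack of truth vectors (`PolyTime.evalStep`).  Because truth vectors have the length of
the model whatever the vectors they are computed from, the stack grows additively.
-/

namespace CoalgLogic

/-! ### A calculus of polynomial-time reductions -/

theorem Data.one_le_size (d : Data) : 1 ≤ d.size := by
  cases d <;> simp [Data.size]

theorem Data.hd_size_add_tl_size (d : Data) : d.hd.size + d.tl.size ≤ d.size + 1 := by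
  cases d with
  | nil => simp [Data.size, Data.hd, Data.tl]
  | cons a b => simp only [Data.size, Data.hd, Data.tl]; omega

theorem polynomial_eval_mono (q : Polynomial ℕ) {m n : ℕ} (h : m ≤ n) : q.eval m ≤ q.eval n := by
  induction q using Polynomial.induction_on' with
  | add p q hp hq => simpa using add_le_add hp hq
  | monomial k a => simpa using Nat.mul_le_mul_left a (Nat.pow_le_pow_left h k)

/-- A program only outputs what it has paid for. -/
theorem Run.size_le {p : Prog} {d e : Data} {n : ℕ} (h : Run p d e n) : e.size ≤ n := by
  cases h <;> simp only [nodeCost] <;> omega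

/-- `PolyTime e g`: from the tree `e a` the tree `g a` is computable in polynomial time, uniformly
in the index `a`.  The index carries the mathematical object that both trees describe; nothing is
said about a program on trees that are not of the form `e a`. -/
def PolyTime {α : Type*} (e g : α → Data) : Prop :=
  ∃ (p : Prog) (q : Polynomial ℕ), ∀ a : α, ∃ n : ℕ, n ≤ q.eval (e a).size ∧ Run p (e a) (g a) n

namespace PolyTime

variable {α : Type*} {β : Type*} {γ : Type*} {e f g : α → Data}

theorem refl (e : α → Data) : PolyTime e e :=
  ⟨.id, 2 * Polynomial.X, fun a => ⟨_, by simp [nodeCost]; omega, .id _⟩⟩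

/-- The index may be changed at will, even without naming the new index as a function of the old
one. -/
theorem reindex {e' g' : β → Data} (H : PolyTime e' g')
    (k : ∀ a, ∃ b, e a = e' b ∧ g a = g' b) : PolyTime e g := by
  obtain ⟨p, q, H⟩ := H
  refine ⟨p, q, fun a => ?_⟩
  obtain ⟨b, h₁, h₂⟩ := k a
  rw [h₁, h₂]
  exact H b

theorem comap (H : PolyTime e g) (k : β → α) :
    PolyTime (fun b => e (k b)) (fun b => g (k b)) :=
  H.reindex fun b => ⟨k b, rfl, rfl⟩

theorem size_le (H : PolyTime e g) :
    ∃ q : Polynomial ℕ, ∀ a, (g a).size ≤ q.eval (e a).size := by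
  obtain ⟨p, q, H⟩ := H
  refine ⟨q, fun a => ?_⟩
  obtain ⟨n, hn, hr⟩ := H a
  exact hr.size_le.trans hn

theorem trans (H : PolyTime e f) (H' : PolyTime f g) : PolyTime e g := by
  obtain ⟨p, q, H⟩ := H
  obtain ⟨p', q', H'⟩ := H'
  refine ⟨.comp p' p, q + q'.comp q + (Polynomial.X + q'.comp q), fun a => ?_⟩
  obtain ⟨n, hn, hr⟩ := H a
  obtain ⟨n', hn', hr'⟩ := H' a
  refine ⟨_, ?_, .comp hr hr'⟩
  have h₁ := hn'.trans (polynomial_eval_mono q' (hr.size_le.trans hn))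
  have h₂ := hr'.size_le
  simp only [Polynomial.eval_add, Polynomial.eval_comp, Polynomial.eval_X, nodeCost]
  omega

theorem cons (H : PolyTime e f) (H' : PolyTime e g) :
    PolyTime e (fun a => .cons (f a) (g a)) := by
  obtain ⟨p, q, H⟩ := H
  obtain ⟨p', q', H'⟩ := H'
  refine ⟨.pair p p', q + q' + (Polynomial.X + (q + q' + 1)), fun a => ?_⟩
  obtain ⟨n, hn, hr⟩ := H a
  obtain ⟨n', hn', hr'⟩ := H' a
  refine ⟨_, ?_, .pair hr hr'⟩
  have h₁ := hr.size_le
  have h₂ := hr'.size_le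
  simp only [Polynomial.eval_add, Polynomial.eval_one, Polynomial.eval_X, nodeCost, Data.size]
  omega

theorem hd (H : PolyTime e f) : PolyTime e (fun a => (f a).hd) := by
  refine H.trans ⟨.hd, 2 * Polynomial.X + 1, fun a => ⟨_, ?_, .hd _⟩⟩
  have := (f a).hd_size_add_tl_size
  simp [nodeCost]
  omega

theorem tl (H : PolyTime e f) : PolyTime e (fun a => (f a).tl) := by
  refine H.trans ⟨.tl, 2 * Polynomial.X + 1, fun a => ⟨_, ?_, .tl _⟩⟩
  have := (f a).hd_size_add_tl_size
  simp [nodeCost]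
  omega

theorem const (e : α → Data) (d : Data) : PolyTime e (fun _ => d) := by
  induction d with
  | nil => exact ⟨.nil, Polynomial.X + 1, fun a => ⟨_, by simp [nodeCost, Data.size], .nil _⟩⟩
  | cons a b ha hb => exact ha.cons hb

/-- Branching on whether `c` is `nil`. -/
theorem ite {c : α → Data} (hc : PolyTime e c)
    (hf : PolyTime (fun a : {a // c a ≠ .nil} => e a) (fun a => g a))
    (hg : PolyTime (fun a : {a // c a = .nil} => e a) (fun a => g a)) : PolyTime e g := by
  obtain ⟨p, q, H⟩ := hc
  obtain ⟨p₁, q₁, H₁⟩ := hf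
  obtain ⟨p₂, q₂, H₂⟩ := hg
  refine ⟨.ite p p₁ p₂, q + q₁ + q₂ + (Polynomial.X + q₁ + q₂), fun a => ?_⟩
  obtain ⟨n, hn, hr⟩ := H a
  simp only [Polynomial.eval_add, Polynomial.eval_X]
  by_cases h : c a = .nil
  · obtain ⟨m, hm, hs⟩ := H₂ ⟨a, h⟩
    refine ⟨_, ?_, .iteFalse (h ▸ hr) hs⟩
    have := hs.size_le
    simp only [nodeCost] at *
    omega
  · obtain ⟨m, hm, hs⟩ := H₁ ⟨a, h⟩
    refine ⟨_, ?_, .iteTrue hr h hs⟩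
    have := hs.size_le
    simp only [nodeCost] at *
    omega

/-- Branching on a computable number below a fixed bound. -/
theorem switch (n : ℕ) : ∀ {α : Type*} {e g : α → Data} (k : α → ℕ), (∀ a, k a < n) →
    PolyTime e (fun a => encUnary (k a)) →
    (∀ j < n, PolyTime (fun a : {a // k a = j} => e a) (fun a => g a)) → PolyTime e g := by
  induction n with
  | zero => exact fun k hk _ _ => ⟨.id, 0, fun a => absurd (hk a) (by omega)⟩
  | succ n ih =>
    intro α e g k hk hc hj
    refine ite hc ?_ ?_
    · refine ih (fun a => k a - 1) (fun a => ?_) ?_ (fun j hjn => ?_)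
      · obtain ⟨a, ha⟩ := a
        have : k a ≠ 0 := fun h => ha (by simp [h, encUnary])
        have := hk a
        simp only
        omega
      · refine (hc.comap Subtype.val).tl.reindex fun a => ⟨a, rfl, ?_⟩
        obtain ⟨a, ha⟩ := a
        cases h : k a with
        | zero => simp [h, encUnary] at ha
        | succ m => simp [encUnary, Data.tl]
      · refine (hj (j + 1) (by omega)).reindex fun a => ⟨⟨a.1.1, ?_⟩, rfl, rfl⟩
        obtain ⟨⟨a, ha⟩, h⟩ := a
        have : k a ≠ 0 := fun h => ha (by simp [h, encUnary])
        simp only at h ⊢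
        omega
    · refine (hj 0 (by omega)).reindex fun a => ⟨⟨a.1, ?_⟩, rfl, rfl⟩
      obtain ⟨a, ha⟩ := a
      cases h : k a with
      | zero => rfl
      | succ m => simp [h, encUnary] at ha

/-- A loop that takes `N i` steps from `S i 0` to `S i (N i)` runs in polynomial time if the
number of its steps and the sizes of all intermediate values are polynomially bounded. -/
theorem loop {ι : Type*} {S : ι → ℕ → Data} {N : ι → ℕ} {c : Data → Data}
    (hc : PolyTime (fun x : {x : ι × ℕ // x.2 ≤ N x.1} => S x.1.1 x.1.2)
      (fun x => c (S x.1.1 x.1.2)))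
    (hend : ∀ i, c (S i (N i)) = .nil) (hgo : ∀ i, ∀ k < N i, c (S i k) ≠ .nil)
    (hf : PolyTime (fun x : {x : ι × ℕ // x.2 < N x.1} => S x.1.1 x.1.2)
      (fun x => S x.1.1 (x.1.2 + 1)))
    (q₁ q₂ : Polynomial ℕ) (hN : ∀ i, N i ≤ q₁.eval (S i 0).size)
    (hS : ∀ i, ∀ k ≤ N i, (S i k).size ≤ q₂.eval (S i 0).size) :
    PolyTime (fun i => S i 0) (fun i => S i (N i)) := by
  obtain ⟨p, q, H⟩ := hc
  obtain ⟨p', q', H'⟩ := hf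
  refine ⟨.loop p p', (q₁ + 1) * (q.comp q₂ + q'.comp q₂ + 2 * q₂), fun i => ?_⟩
  set B : ℕ := (q.comp q₂ + q'.comp q₂ + 2 * q₂).eval (S i 0).size with hB
  have hB' : B = q.eval (q₂.eval (S i 0).size) + q'.eval (q₂.eval (S i 0).size) +
      2 * q₂.eval (S i 0).size := by simp [hB, Polynomial.eval_comp]
  -- the cost is bounded by backward induction on the number `j` of remaining steps
  have key : ∀ j ≤ N i, ∃ n ≤ (j + 1) * B, Run (.loop p p') (S i (N i - j)) (S i (N i)) n := by
    intro j
    induction j with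
    | zero =>
      intro _
      obtain ⟨n, hn, hr⟩ := H ⟨(i, N i), le_refl _⟩
      simp only [hend] at hr hn
      have hs := hS i (N i) le_rfl
      have := polynomial_eval_mono q hs
      rw [Nat.sub_zero]
      refine ⟨_, ?_, .loopStop hr⟩
      simp only [nodeCost]
      omega
    | succ j ih =>
      intro hj
      obtain ⟨k, hk, hrk⟩ := ih (by omega)
      have hlt : N i - (j + 1) < N i := by omega
      obtain ⟨n, hn, hr⟩ := H ⟨(i, N i - (j + 1)), hlt.le⟩
      obtain ⟨m, hm, hr'⟩ := H' ⟨(i, N i - (j + 1)), hlt⟩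
      have e₁ : N i - (j + 1) + 1 = N i - j := by omega
      simp only [e₁] at hr hn hr' hm
      refine ⟨_, ?_, .loopStep hr (hgo i _ hlt) hr' hrk⟩
      have h₁ := hS i _ hlt.le
      have h₂ := hS i (N i) le_rfl
      have h₃ := polynomial_eval_mono q h₁
      have h₄ := polynomial_eval_mono q' h₁
      simp only [nodeCost]
      have : (j + 1 + 1) * B = (j + 1) * B + B := by ring
      omega
  obtain ⟨n, hn, hr⟩ := key (N i) le_rfl
  rw [Nat.sub_self] at hr
  refine ⟨n, hn.trans ?_, hr⟩
  rw [Polynomial.eval_mul]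
  refine Nat.mul_le_mul ?_ le_rfl
  simpa using hN i

end PolyTime

/-! ### Folding over lists -/

theorem encList_size_le {α : Type*} {enc : α → Data} {B : ℕ} {l : List α}
    (h : ∀ a ∈ l, (enc a).size ≤ B) : (encList enc l).size ≤ l.length * (B + 1) + 1 := by
  induction l with
  | nil => simp [encList, Data.size]
  | cons a l ih =>
    have h₁ := h a (by simp)
    have h₂ := ih fun b hb => h b (by simp [hb])
    simp only [encList, Data.size, List.length_cons]
    rw [Nat.succ_mul]
    omega

theorem length_lt_encList_size {α : Type*} (enc : α → Data) (l : List α) :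
    l.length < (encList enc l).size := by
  induction l with
  | nil => simp [encList, Data.size]
  | cons a l ih =>
    simp only [encList, Data.size, List.length_cons]
    omega

theorem size_lt_encList_size {α : Type*} (enc : α → Data) {l : List α} {a : α} (h : a ∈ l) :
    (enc a).size < (encList enc l).size := by
  induction l with
  | nil => simp at h
  | cons b l ih =>
    have := Data.one_le_size (encList enc l)
    simp only [encList, Data.size]
    rcases List.mem_cons.1 h with rfl | h
    · omega
    · have := ih h
      omega

theorem encList_drop_size_le {α : Type*} (enc : α → Data) (l : List α) (k : ℕ) :
    (encList enc (l.drop k)).size ≤ (encList enc l).size := by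
  induction l generalizing k with
  | nil => simp
  | cons a l ih =>
    cases k with
    | zero => simp
    | succ k =>
      have := ih k
      simp only [List.drop_succ_cons, encList, Data.size]
      omega

namespace PolyTime

variable {ι : Type*} {α : Type*} {β : Type*} {γ : Type*} {e : ι → Data}

/-- A left fold is computable in polynomial time if its step is, provided that a step increases
the size of the accumulator at most by an amount that is polynomial in the sizes of the remaining
data (and does not depend on the accumulator). -/
theorem foldl {env : ι → Data} {eβ : β → Data} {eγ : γ → Data} {f : ι → γ → β → γ}
    {l : ι → List β} {c : ι → γ}
    (hf : PolyTime (fun x : ι × γ × β => .cons (env x.1) (.cons (eγ x.2.1) (eβ x.2.2)))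
      (fun x => eγ (f x.1 x.2.1 x.2.2)))
    (q : Polynomial ℕ)
    (hq : ∀ i c b, (eγ (f i c b)).size ≤ (eγ c).size + q.eval ((env i).size + (eβ b).size))
    (henv : PolyTime e env) (hl : PolyTime e (fun i => encList eβ (l i)))
    (hc : PolyTime e (fun i => eγ (c i))) :
    PolyTime e (fun i => eγ ((l i).foldl (f i) (c i))) := by
  -- after `k` steps, the loop holds the environment, the remaining list and the accumulator
  let S : ι → ℕ → Data := fun i k =>
    .cons (env i) (.cons (encList eβ ((l i).drop k)) (eγ (((l i).take k).foldl (f i) (c i))))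
  have start : PolyTime e (fun i => S i 0) := by
    simpa [S] using henv.cons (hl.cons hc)
  have main : PolyTime (fun i => S i 0) (fun i => S i (l i).length) := by
    refine loop (c := fun d => d.tl.hd) (refl _).tl.hd ?_ ?_ ?_ Polynomial.X
      (Polynomial.X + Polynomial.X + Polynomial.X * q) ?_ ?_
    · intro i
      simp [S, Data.hd, Data.tl, encList]
    · intro i k hk
      simp only [S, Data.hd, Data.tl]
      rw [List.drop_eq_getElem_cons hk]
      simp [encList]
    · -- the step is applied to the accumulator and the element reached after `x.1.2` steps
      have hstep := hf.comap
        (fun x : {x : ι × ℕ // x.2 < (l x.1).length} =>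
          (x.1.1, ((l x.1.1).take x.1.2).foldl (f x.1.1) (c x.1.1), (l x.1.1)[x.1.2]'x.2))
      let S' := fun x : {x : ι × ℕ // x.2 < (l x.1).length} => S x.1.1 x.1.2
      have hS' := refl S'
      refine (hS'.hd.cons (hS'.tl.hd.tl.cons
        ((hS'.hd.cons (hS'.tl.tl.cons hS'.tl.hd.hd)).trans
          (hstep.reindex fun x => ⟨x, ?_, rfl⟩)))).reindex fun x => ⟨x, rfl, ?_⟩
      · obtain ⟨⟨i, k⟩, hk⟩ := x
        simp only [S', S, Data.hd, Data.tl]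
        rw [List.drop_eq_getElem_cons hk]
        simp [encList]
      · obtain ⟨⟨i, k⟩, hk⟩ := x
        simp only [S', S, Data.hd, Data.tl]
        rw [List.drop_eq_getElem_cons hk, List.take_succ_eq_append_getElem hk,
          List.foldl_append]
        rfl
    · intro i
      have := length_lt_encList_size eβ (l i)
      simp only [S, List.drop_zero, Data.size, Polynomial.eval_X]
      omega
    · intro i k hk
      have hacc : ∀ k ≤ (l i).length, (eγ (((l i).take k).foldl (f i) (c i))).size ≤
          (eγ (c i)).size + k * q.eval ((env i).size + (encList eβ (l i)).size) := by
        intro k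
        induction k with
        | zero => simp
        | succ k ih =>
          intro hk
          have hk' : k < (l i).length := hk
          rw [List.take_succ_eq_append_getElem hk', List.foldl_append]
          have h₁ := hq i (((l i).take k).foldl (f i) (c i)) (l i)[k]
          have h₂ := ih hk'.le
          have h₃ := polynomial_eval_mono q (Nat.add_le_add_left
            (size_lt_encList_size eβ (List.getElem_mem hk')).le (env i).size)
          simp only [List.foldl_cons, List.foldl_nil]
          rw [Nat.succ_mul]
          omega
      have h₁ := hacc k hk
      have h₂ := encList_drop_size_le eβ (l i) k
      have h₃ := length_lt_encList_size eβ (l i)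
      have h₄ : (env i).size + (encList eβ (l i)).size ≤ (S i 0).size := by
        simp only [S, Data.size, List.drop_zero]
        omega
      have h₅ : k * q.eval ((env i).size + (encList eβ (l i)).size) ≤
          (S i 0).size * q.eval (S i 0).size :=
        Nat.mul_le_mul (by omega) (polynomial_eval_mono q h₄)
      simp only [Polynomial.eval_add, Polynomial.eval_mul, Polynomial.eval_X]
      have h₆ : (S i k).size ≤ (S i 0).size +
          k * q.eval ((env i).size + (encList eβ (l i)).size) := by
        simp only [S, Data.size, List.drop_zero, List.take_zero, List.foldl_nil]
        omega
      omega
  refine ((start.trans main).tl.tl).reindex fun i => ⟨i, rfl, ?_⟩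
  simp [S, Data.tl]

theorem reverse {eβ : β → Data} {l : ι → List β} (hl : PolyTime e (fun i => encList eβ (l i))) :
    PolyTime e (fun i => encList eβ (l i).reverse) := by
  have hx := refl (fun x : ι × List β × β =>
    Data.cons Data.nil (.cons (encList eβ x.2.1) (eβ x.2.2)))
  have := foldl (f := fun _ acc b => b :: acc) (c := fun _ => []) (eγ := encList eβ)
    (env := fun _ => .nil) (hx.tl.tl.cons hx.tl.hd) (Polynomial.X + 1)
    (fun i c b => by simp [encList, Data.size]; omega) (const e .nil) hl (const e .nil)
  refine this.reindex fun i => ⟨i, rfl, ?_⟩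
  simp

theorem map {env : ι → Data} {eβ : β → Data} {eγ : γ → Data} {f : ι → β → γ} {l : ι → List β}
    (hf : PolyTime (fun x : ι × β => .cons (env x.1) (eβ x.2)) (fun x => eγ (f x.1 x.2)))
    (henv : PolyTime e env) (hl : PolyTime e (fun i => encList eβ (l i))) :
    PolyTime e (fun i => encList eγ ((l i).map (f i))) := by
  obtain ⟨q, hq⟩ := hf.size_le
  have hx := refl (fun x : ι × List γ × β =>
    Data.cons (env x.1) (.cons (encList eγ x.2.1) (eβ x.2.2)))
  have hstep := (hx.hd.cons hx.tl.tl).trans (hf.comap fun x : ι × List γ × β => (x.1, x.2.2))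
  -- a fold that prepends reverses, so it is applied to the reversed list
  have := foldl (f := fun i acc b => f i b :: acc) (c := fun _ => []) (eγ := encList eγ)
    (hstep.cons hx.tl.hd) (q.comp (Polynomial.X + 1) + 1)
    (fun i c b => by
      have := hq (i, b)
      simp only [Data.size] at this
      simp only [encList, Data.size, Polynomial.eval_add, Polynomial.eval_comp, Polynomial.eval_X,
        Polynomial.eval_one]
      omega) henv hl.reverse (const e .nil)
  refine this.reindex fun i => ⟨i, rfl, ?_⟩
  rw [List.foldl_reverse]
  congr 1
  induction l i with
  | nil => rfl
  | cons a l ih => rw [List.map_cons, ih, List.foldr_cons]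

end PolyTime

/-! ### The coalgebra of an abstract wsi model -/

section Realization

variable {T : Type u → Type u} [Functor T] {Λ : Type v} {I : Interpretation T Λ}

/-- A conjunctive formula is equivalent to the conjunction of its conjuncts. -/
theorem mem_extension_iff_forall_conjuncts {X : Type u} {ξ : X → T X} {x : X} {φ : Formula Λ}
    (hφ : φ.IsConjunctive) :
    x ∈ extension I ξ φ ↔ ∀ c ∈ φ.conjuncts, ξ x ∈ I.lift c.1 X (extension I ξ c.2) := by
  induction φ with
  | top => simp [extension, Formula.conjuncts]
  | bot => exact hφ.elim
  | or => exact hφ.elim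
  | and φ ψ ih₁ ih₂ =>
    simp only [extension, Formula.conjuncts, Set.mem_inter_iff, ih₁ hφ.1, ih₂ hφ.2,
      Set.mem_union, or_imp, forall_and]
  | mod h φ _ => simp [extension, Formula.conjuncts]

/-- The conjunction of the variables in a list. -/
def conjVars (l : List ℕ) : PosProp ℕ := l.foldl (fun ρ p => .and (.var p) ρ) .top

/-- The formula `⋁ₓ ⋀ₚ p`, where `x` ranges over those elements of a one-step model, listed with
their states and variables in `l`, whose state is marked as true in the truth vector `v`, and `p`
ranges over the variables that hold at `x`. -/
def disjMarked (v : List Bool) (l : List (ℕ × List ℕ)) : PosProp ℕ :=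
  l.foldl (fun ρ x => if v.getD x.1 false = true then .or (conjVars x.2) ρ else ρ) .bot

theorem mem_extension_conjVars {X : Type u} {θ : ℕ → Set X} {y : X} {l : List ℕ} :
    y ∈ (conjVars l).extension θ ↔ ∀ p ∈ l, y ∈ θ p := by
  have : ∀ ρ : PosProp ℕ, y ∈ (l.foldl (fun ρ p => .and (.var p) ρ) ρ).extension θ ↔
      y ∈ ρ.extension θ ∧ ∀ p ∈ l, y ∈ θ p := by
    induction l with
    | nil => simp
    | cons p l ih =>
      intro ρ
      rw [List.foldl_cons, ih]
      simp only [PosProp.extension, Set.mem_inter_iff, List.forall_mem_cons]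
      tauto
  exact (this .top).trans (by simp [PosProp.extension])

theorem mem_extension_disjMarked {X : Type u} {θ : ℕ → Set X} {y : X} {v : List Bool}
    {l : List (ℕ × List ℕ)} :
    y ∈ (disjMarked v l).extension θ ↔
      ∃ x ∈ l, v.getD x.1 false = true ∧ ∀ p ∈ x.2, y ∈ θ p := by
  have : ∀ ρ : PosProp ℕ, y ∈ (l.foldl (fun ρ x => if v.getD x.1 false = true then
      .or (conjVars x.2) ρ else ρ) ρ).extension θ ↔
      y ∈ ρ.extension θ ∨ ∃ x ∈ l, v.getD x.1 false = true ∧ ∀ p ∈ x.2, y ∈ θ p := by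
    induction l with
    | nil => simp
    | cons x l ih =>
      intro ρ
      rw [List.foldl_cons, ih]
      simp only [List.exists_mem_cons_iff]
      split_ifs with h
      · simp only [PosProp.extension, Set.mem_union, mem_extension_conjVars]
        tauto
      · tauto
  exact (this .bot).trans (by simp [PosProp.extension])

/-- The states of an abstract model, lifted to the universe of the functor. -/
abbrev AbstractModel.State (A : AbstractModel Λ) : Type u := ULift.{u} (Fin A.card)

/-- The state to which an element of the one-step model stored at `N` is attached. -/
def AbstractNode.attach {n : ℕ} (N : AbstractNode Λ n) (x : AbstractNode.Carrier.{u} N) :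
    ULift.{u} (Fin n) :=
  ⟨(N.succ.get x.down).1⟩

/-- The coalgebra structure that a choice of the missing components `t` of the one-step models
induces on the states of an abstract model. -/
def AbstractModel.coalg (A : AbstractModel Λ)
    (t : ∀ s, T (AbstractNode.Carrier.{u} (A.node s))) (s : AbstractModel.State.{u} A) :
    T (AbstractModel.State.{u} A) :=
  (A.node s.down).attach <$> t s.down

theorem AbstractModel.mem_extension_mod {A : AbstractModel Λ}
    {t : ∀ s, T (AbstractNode.Carrier.{u} (A.node s))} {s : Fin A.card} {h : Λ} {χ : Formula Λ} :
    ULift.up s ∈ extension I (A.coalg t) (.mod h χ) ↔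
      t s ∈ I.lift h _ ((A.node s).attach ⁻¹' extension I (A.coalg t) χ) := by
  rw [I.natural]
  rfl

/-- Choices of what an abstract wsi model `A` for `φ` leaves implicit: the components `t` of the
one-step models, and the substitutions `ρ`. -/
structure Realization (I : Interpretation T Λ) (A : AbstractModel Λ) (φ : Formula Λ) where
  t : ∀ s, T (AbstractNode.Carrier.{u} (A.node s))
  wsi : ∀ s, IsOneStepWsi I (A.node s).form (A.node s).valuation (t s)
  ρ : Fin A.card → ℕ → Formula Λ
  conjunctive : ∀ s p, (ρ s p).IsConjunctive
  root : substConjuncts (A.node A.root).form (ρ A.root) = φ.conjuncts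
  succ : ∀ s, ∀ x ∈ (A.node s).succ,
    substConjuncts (A.node x.1).form (ρ x.1) = ⋃ p ∈ x.2, (ρ s p).conjuncts

theorem IsAbstractWsi.nonempty_realization {A : AbstractModel Λ} {φ : Formula Λ}
    (h : IsAbstractWsi I A φ) : Nonempty (Realization I A φ) := by
  choose t ht using h.wsi
  obtain ⟨ρ, h₁, -, h₂, h₃⟩ := h.subst
  exact ⟨⟨t, ht, ρ, h₁, h₂, h₃⟩⟩

namespace Realization

variable {A : AbstractModel Λ} {φ : Formula Λ} (R : Realization I A φ)

/-- The conjuncts of the formula that the state `s` realizes. -/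
def theory (s : Fin A.card) : Set (Λ × Formula Λ) := substConjuncts (A.node s).form (R.ρ s)

theorem theory_attach (s : Fin A.card) (x : AbstractNode.Carrier.{u} (A.node s)) :
    R.theory ((A.node s).attach x).down =
      ⋃ p ∈ {p | x ∈ (A.node s).valuation p}, (R.ρ s p).conjuncts :=
  R.succ s _ (List.get_mem _ _)

/-- A state satisfies the formula that it realizes; the induction needs this for all formulas built
from some of the conjuncts. -/
theorem mem_extension_of_conjuncts_subset {χ : Formula Λ} (hχ : χ.IsConjunctive) :
    ∀ {s}, χ.conjuncts ⊆ R.theory s → ULift.up s ∈ extension I (A.coalg R.t) χ := by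
  induction χ with
  | top => exact fun _ => trivial
  | bot => exact hχ.elim
  | or => exact hχ.elim
  | and φ ψ ih₁ ih₂ =>
    exact fun h => ⟨ih₁ hχ.1 (Set.subset_union_left.trans h),
      ih₂ hχ.2 (Set.subset_union_right.trans h)⟩
  | mod h χ ih =>
    intro s hs
    obtain ⟨a, ha, hac⟩ := hs rfl
    obtain ⟨rfl, rfl⟩ := Prod.mk.inj hac
    rw [AbstractModel.mem_extension_mod]
    refine I.mono _ _ _ _ (fun x hx => ?_) ((R.wsi s).1 a ha)
    refine ih (s := ((A.node s).attach x).down) hχ ?_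
    rw [R.theory_attach]
    exact Set.subset_biUnion_of_mem (u := fun p => (R.ρ s p).conjuncts) hx

/-- Every state is simulated by every state of every coalgebra that satisfies the formula which
the former realizes. -/
theorem mem_extension_of_forall_theory {Y : Type u} (ζ : Y → T Y) (χ : Formula Λ) :
    ∀ {s} {y : Y}, (∀ c ∈ R.theory s, ζ y ∈ I.lift c.1 Y (extension I ζ c.2)) →
      ULift.up s ∈ extension I (A.coalg R.t) χ → y ∈ extension I ζ χ := by
  induction χ with
  | top => exact fun _ _ => trivial
  | bot => exact fun _ h => h.elim
  | and φ ψ ih₁ ih₂ => exact fun hy h => ⟨ih₁ hy h.1, ih₂ hy h.2⟩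
  | or φ ψ ih₁ ih₂ => exact fun hy h => h.imp (ih₁ hy) (ih₂ hy)
  | mod h χ ih =>
    intro s y hy hs
    rw [AbstractModel.mem_extension_mod] at hs
    -- `Y` becomes a one-step model by letting each variable hold where its substitute does
    refine I.mono _ _ _ _ ?_ ((R.wsi s).2 Y (fun p => extension I ζ (R.ρ s p)) (ζ y)
      (fun a ha => hy _ ⟨a, ha, rfl⟩) h _ hs)
    rintro z ⟨x, hx, hxz⟩
    refine ih (s := ((A.node s).attach x).down) (fun c hc => ?_) hx
    rw [R.theory_attach] at hc
    obtain ⟨p, hp, hc⟩ := Set.mem_iUnion₂.1 hc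
    exact (mem_extension_iff_forall_conjuncts (R.conjunctive s p)).1 (hxz p hp) c hc

theorem subsumes_iff (hφ : φ.IsConjunctive) (ψ : Formula Λ) :
    Subsumes I φ ψ ↔ ULift.up A.root ∈ extension I (A.coalg R.t) ψ := by
  constructor
  · exact fun h => h _ _ (R.mem_extension_of_conjuncts_subset hφ R.root.symm.subset)
  · intro h Y ζ y hy
    refine R.mem_extension_of_forall_theory ζ ψ (fun c hc => ?_) h
    exact (mem_extension_iff_forall_conjuncts hφ).1 hy c (R.root.subset hc)

/-- Modal formulas at a state reduce to one-step consequence.  From right to left, one uses that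
the set of all `x` attached to a state satisfying `χ` is closed under adding variables. -/
theorem mem_extension_mod_iff {χ : Formula Λ} {v : List Bool}
    (hv : ∀ s : Fin A.card,
      v.getD s false = true ↔ ULift.up s ∈ extension I (A.coalg R.t) χ)
    (s : Fin A.card) (h : Λ) :
    ULift.up s ∈ extension I (A.coalg R.t) (.mod h χ) ↔
      OneStepConsequence I (A.node s).form h
        (disjMarked v ((A.node s).succ.map fun x => (x.1.val, x.2))) := by
  have hdisj : ∀ {Y : Type u} {θ : ℕ → Set Y} {y : Y},
      y ∈ (disjMarked v ((A.node s).succ.map fun x => (x.1.val, x.2))).extension θ ↔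
      ∃ x ∈ (A.node s).attach ⁻¹' extension I (A.coalg R.t) χ,
        ∀ p, x ∈ (A.node s).valuation p → y ∈ θ p := by
    intro Y θ y
    rw [mem_extension_disjMarked]
    constructor
    · rintro ⟨_, hx, hvx, hy⟩
      obtain ⟨x, hx', rfl⟩ := List.mem_map.1 hx
      obtain ⟨i, rfl⟩ := List.get_of_mem hx'
      exact ⟨⟨i⟩, (hv _).1 hvx, hy⟩
    · rintro ⟨x, hx, hy⟩
      exact ⟨_, List.mem_map_of_mem (List.get_mem _ x.down), (hv _).2 hx, hy⟩
  rw [AbstractModel.mem_extension_mod]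
  constructor
  · intro hs Y θ r hr
    refine I.mono _ _ _ _ (fun y hy => ?_) ((R.wsi s).2 Y θ r hr h _ hs)
    exact hdisj.2 hy
  · intro hc
    refine I.mono _ _ _ _ (fun y hy => ?_) (hc _ _ _ (R.wsi s).1)
    obtain ⟨x, hx, hxy⟩ := hdisj.1 hy
    -- `y` carries all variables of `x`, so its state satisfies the formula that the state of `x`
    -- realizes
    refine R.mem_extension_of_forall_theory _ χ (s := ((A.node s).attach x).down)
      (fun c hc => ?_) hx
    have hc' : c ∈ R.theory ((A.node s).attach y).down := by
      rw [R.theory_attach] at hc ⊢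
      exact Set.biUnion_subset_biUnion_left hxy hc
    obtain ⟨a, ha, rfl⟩ := hc'
    refine R.mem_extension_of_conjuncts_subset (χ := .mod a.1 (R.ρ _ a.2))
      (R.conjunctive _ _) ?_
    rintro _ rfl
    exact ⟨a, ha, rfl⟩

end Realization

end Realization

/-! ### Polynomial-time operations on truth vectors and one-step formulas -/

/-- The encoding of truth vectors, which list a truth value for every state. -/
abbrev encVec : List Bool → Data := encList encBool

theorem size_encBool_le (b : Bool) : (encBool b).size ≤ 3 := by
  cases b <;> simp [encBool, Data.size]

theorem size_encVec_le (v : List Bool) : (encVec v).size ≤ 4 * v.length + 1 := by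
  have := encList_size_le (l := v) fun b _ => size_encBool_le b
  rw [encVec]
  omega

theorem encList_tail {α : Type*} (enc : α → Data) (l : List α) :
    encList enc l.tail = (encList enc l).tl := by
  cases l <;> rfl

theorem encVec_headD (v : List Bool) : encBool (v.headD false) = (encVec v).hd := by
  cases v <;> rfl

theorem encList_headD_nil {α : Type*} (enc : α → Data) (l : List (List α)) :
    encList enc (l.headD []) = (encList (encList enc) l).hd := by
  cases l <;> rfl

theorem encUnary_eq_encList (n : ℕ) :
    encUnary n = encList (fun _ : Unit => Data.nil) (List.replicate n ()) := by
  induction n with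
  | zero => rfl
  | succ n ih => rw [List.replicate_succ, encUnary, encList, ih]

namespace PolyTime

variable {ι : Type*} {e : ι → Data}

theorem ite_bool {c : ι → Bool} {g₁ g₂ : ι → Data} (hc : PolyTime e (fun i => encBool (c i)))
    (h₁ : PolyTime e g₁) (h₂ : PolyTime e g₂) :
    PolyTime e (fun i => if c i = true then g₁ i else g₂ i) := by
  refine hc.ite ?_ ?_
  · refine (h₁.comap Subtype.val).reindex fun a => ⟨a, rfl, ?_⟩
    obtain ⟨a, ha⟩ := a
    have h : c a = true := by
      cases h : c a
      · exact absurd (congrArg encBool h) ha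
      · rfl
    simp [h]
  · refine (h₂.comap Subtype.val).reindex fun a => ⟨a, rfl, ?_⟩
    obtain ⟨a, ha⟩ := a
    have h : c a = false := by
      cases h : c a
      · rfl
      · rw [h] at ha
        cases ha
    simp [h]

theorem bool_op (op : Bool → Bool → Bool) {b c : ι → Bool}
    (hb : PolyTime e (fun i => encBool (b i))) (hc : PolyTime e (fun i => encBool (c i))) :
    PolyTime e (fun i => encBool (op (b i) (c i))) := by
  refine (ite_bool hb
    (ite_bool hc (const e (encBool (op true true))) (const e (encBool (op true false))))
    (ite_bool hc (const e (encBool (op false true)))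
      (const e (encBool (op false false))))).reindex fun i => ⟨i, rfl, ?_⟩
  cases b i <;> cases c i <;> rfl

theorem getD {v : ι → List Bool} {n : ι → ℕ} (hv : PolyTime e (fun i => encVec (v i)))
    (hn : PolyTime e (fun i => encUnary (n i))) :
    PolyTime e (fun i => encBool ((v i).getD (n i) false)) := by
  have hx := refl (fun x : ι × List Bool × Unit =>
    Data.cons Data.nil (.cons (encVec x.2.1) Data.nil))
  -- the entry at position `n` is the head after dropping `n` entries
  have := foldl (f := fun _ w _ => w.tail) (l := fun i => List.replicate (n i) ()) (c := v)
    (env := fun _ => .nil) (eγ := encVec) (eβ := fun _ => .nil)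
    (hx.tl.hd.tl.reindex fun x => ⟨x, rfl, encList_tail _ _⟩) 0
    (fun i w _ => by
      have := encList_drop_size_le encBool w 1
      simpa using this) (const e .nil)
    (hn.reindex fun i => ⟨i, rfl, (encUnary_eq_encList _).symm⟩) hv
  refine this.hd.reindex fun i => ⟨i, rfl, ?_⟩
  rw [← encVec_headD]
  congr 1
  generalize v i = w
  induction n i generalizing w with
  | zero => cases w <;> rfl
  | succ k ih =>
    rw [List.replicate_succ, List.foldl_cons, ← ih]
    cases w <;> simp

end PolyTime

/-- Pointwise application of a Boolean operation to two truth vectors, which are cut or padded to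
the length of the list `M`. -/
def combine {β : Type*} (op : Bool → Bool → Bool) : List β → List Bool → List Bool → List Bool
  | [], _, _ => []
  | _ :: M, v, w => op (v.headD false) (w.headD false) :: combine op M v.tail w.tail

theorem length_combine {β : Type*} (op : Bool → Bool → Bool) (M : List β) (v w : List Bool) :
    (combine op M v w).length = M.length := by
  induction M generalizing v w with
  | nil => rfl
  | cons a M ih => simp [combine, ih]

theorem getD_combine {β : Type*} (op : Bool → Bool → Bool) {M : List β} {v w : List Bool} {i : ℕ}
    (hi : i < M.length) :
    (combine op M v w).getD i false = op (v.getD i false) (w.getD i false) := by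
  induction M generalizing v w i with
  | nil => simp at hi
  | cons a M ih =>
    cases i with
    | zero => cases v <;> cases w <;> rfl
    | succ i =>
      have := ih (v := v.tail) (w := w.tail) (i := i) (by simpa using hi)
      cases v <;> cases w <;> simpa [combine] using this

theorem PolyTime.combine {ι β : Type*} {e : ι → Data} {eβ : β → Data} (op : Bool → Bool → Bool)
    {M : ι → List β} {v w : ι → List Bool} (hM : PolyTime e (fun i => encList eβ (M i)))
    (hv : PolyTime e (fun i => encVec (v i))) (hw : PolyTime e (fun i => encVec (w i))) :
    PolyTime e (fun i => encVec (combine op (M i) (v i) (w i))) := by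
  -- the accumulator holds the rests of both vectors and the reversed output
  let eγ : List Bool × List Bool × List Bool → Data := fun c =>
    .cons (encVec c.1) (.cons (encVec c.2.1) (encVec c.2.2))
  have hx := refl (fun x : ι × (List Bool × List Bool × List Bool) × β =>
    Data.cons Data.nil (.cons (eγ x.2.1) (eβ x.2.2)))
  have h₁ := hx.tl.hd.hd
  have h₂ := hx.tl.hd.tl.hd
  have h₃ := hx.tl.hd.tl.tl
  have hop := bool_op op (h₁.hd.reindex fun x => ⟨x, rfl, encVec_headD x.2.1.1⟩)
    (h₂.hd.reindex fun x => ⟨x, rfl, encVec_headD x.2.1.2.1⟩)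
  have := foldl (e := e) (l := M) (eγ := eγ) (eβ := eβ) (env := fun _ => .nil)
    (f := fun _ c _ => (c.1.tail, c.2.1.tail, op (c.1.headD false) (c.2.1.headD false) :: c.2.2))
    (c := fun i => (v i, w i, []))
    ((h₁.tl.cons (h₂.tl.cons (hop.cons h₃))).reindex fun x => ⟨x, rfl, by
      simp only [eγ, encList_tail, encList]; rfl⟩)
    4 (fun i c _ => by
      have h₁ := encList_drop_size_le encBool c.1 1
      have h₂ := encList_drop_size_le encBool c.2.1 1
      have h₃ := size_encBool_le (op (c.1.headD false) (c.2.1.headD false))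
      rw [List.drop_one] at h₁ h₂
      simp only [eγ, encVec, encList, Data.size, Polynomial.eval_ofNat]
      omega) (const e .nil) hM (hv.cons (hw.cons (const e .nil)))
  refine (PolyTime.reverse (this.tl.tl)).reindex fun i => ⟨i, rfl, ?_⟩
  congr 1
  have key : ∀ (M : List β) (v w o : List Bool),
      (M.foldl (fun c _ => (c.1.tail, c.2.1.tail,
        op (c.1.headD false) (c.2.1.headD false) :: c.2.2)) (v, w, o)).2.2.reverse =
      o.reverse ++ CoalgLogic.combine op M v w := by
    intro M
    induction M with
    | nil => simp [CoalgLogic.combine]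
    | cons a M ih =>
      intro v w o
      rw [List.foldl_cons, ih]
      simp [CoalgLogic.combine]
  rw [key]
  rfl

theorem PolyTime.conjVars {ι : Type*} {e : ι → Data} {l : ι → List ℕ}
    (hl : PolyTime e (fun i => encList encNat (l i))) :
    PolyTime e (fun i => encPosProp (conjVars (l i))) := by
  have hx := refl (fun x : ι × PosProp ℕ × ℕ =>
    Data.cons Data.nil (.cons (encPosProp x.2.1) (encNat x.2.2)))
  exact foldl (f := fun _ ρ p => .and (.var p) ρ) (c := fun _ => .top)
    (env := fun _ => .nil) (eγ := encPosProp) (eβ := encNat)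
    ((const _ (encUnary 2)).cons (((const _ (encUnary 4)).cons hx.tl.tl).cons hx.tl.hd))
    (Polynomial.X + 20) -- the constant covers the tags and the pairing nodes
    (fun i ρ p => by
      simp only [encPosProp, encUnary, Data.size, Polynomial.eval_add, Polynomial.eval_X,
        Polynomial.eval_ofNat]
      omega) (const e .nil) hl (const e (encPosProp .top))

theorem PolyTime.disjMarked {ι : Type*} {e : ι → Data} {v : ι → List Bool}
    {l : ι → List (ℕ × List ℕ)} (hv : PolyTime e (fun i => encVec (v i)))
    (hl : PolyTime e (fun i =>
      encList (fun x => .cons (encUnary x.1) (encList encNat x.2)) (l i))) :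
    PolyTime e (fun i => encPosProp (disjMarked (v i) (l i))) := by
  have hx := refl (fun x : List Bool × PosProp ℕ × (ℕ × List ℕ) =>
    Data.cons (encVec x.1) (.cons (encPosProp x.2.1)
      (.cons (encUnary x.2.2.1) (encList encNat x.2.2.2))))
  have hconj := PolyTime.conjVars hx.tl.tl.tl
  obtain ⟨q, hq⟩ := (PolyTime.conjVars (PolyTime.refl fun l => encList encNat l)).size_le
  have hstep := ite_bool (hx.hd.getD hx.tl.tl.hd)
    ((const _ (encUnary 3)).cons (hconj.cons hx.tl.hd)) hx.tl.hd
  refine foldl (f := fun i ρ x => if (v i).getD x.1 false = true then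
      .or (CoalgLogic.conjVars x.2) ρ else ρ) (c := fun _ => .bot)
    (env := fun i => encVec (v i)) (eγ := encPosProp)
    ((hstep.comap fun x : ι × PosProp ℕ × (ℕ × List ℕ) => (v x.1, x.2)).reindex
      fun x => ⟨x, rfl, ?_⟩)
    (q + 20) (fun i ρ x => ?_) hv hl (const e (encPosProp .bot))
  · simp only
    split_ifs <;> rfl
  · rw [Polynomial.eval_add, Polynomial.eval_ofNat]
    split_ifs
    · have h₁ := (hq x.2).trans (polynomial_eval_mono q (n := (encVec (v i)).size +
        (Data.cons (encUnary x.1) (encList encNat x.2)).size) (by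
          simp only [Data.size]; omega))
      simp only [encPosProp, encUnary, Data.size] at h₁ ⊢
      omega
    · omega

/-! ### Model checking an abstract model -/

section Raw

variable {Λ : Type v}

/-- A state of an abstract model, with references to states as plain numbers: this makes the type
of nodes independent of the model. -/
abbrev RawNode (Λ : Type v) := OneStepConj Λ ℕ × List (ℕ × List ℕ)

/-- The encoding of raw nodes, which agrees with that of nodes. -/
def encRawNode (code : Λ → Data) (N : RawNode Λ) : Data :=
  .cons (encOneStepConj code N.1)
    (encList (fun x => .cons (encUnary x.1) (encList encNat x.2)) N.2)

/-- The raw node underlying a state of an abstract model. -/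
def AbstractNode.raw {n : ℕ} (N : AbstractNode Λ n) : RawNode Λ :=
  (N.form, N.succ.map fun x => (x.1.val, x.2))

/-- The list of raw nodes underlying an abstract model. -/
def AbstractModel.raw (A : AbstractModel Λ) : List (RawNode Λ) :=
  (List.ofFn A.node).map AbstractNode.raw

theorem encList_map {α β : Type*} (enc : β → Data) (f : α → β) (l : List α) :
    encList enc (l.map f) = encList (fun a => enc (f a)) l := by
  induction l with
  | nil => rfl
  | cons a l ih => simp [encList, ih]

theorem encRawNode_raw (code : Λ → Data) {n : ℕ} (N : AbstractNode Λ n) :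
    encRawNode code N.raw = encNode code N := by
  simp [encRawNode, AbstractNode.raw, encNode, encList_map]

theorem encModel_eq (code : Λ → Data) (A : AbstractModel Λ) :
    encModel code A = .cons (encUnary A.root) (encList (encRawNode code) A.raw) := by
  simp only [encModel, AbstractModel.raw, encList_map, encRawNode_raw]

/-- The truth vector of `♥χ`, given a decision procedure `d` for one-step consequence and the
truth vector `v` of `χ`. -/
def modVec (d : OneStepConj Λ ℕ × Λ × PosProp ℕ → Bool) (M : List (RawNode Λ)) (h : Λ)
    (v : List Bool) : List Bool :=
  M.map fun N => d (N.1, h, disjMarked v N.2)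

/-- The truth vector of a formula over all states of an abstract model. -/
def truthVec (d : OneStepConj Λ ℕ × Λ × PosProp ℕ → Bool) (M : List (RawNode Λ)) :
    Formula Λ → List Bool
  | .top => M.map fun _ => true
  | .bot => M.map fun _ => false
  | .and φ ψ => combine (· && ·) M (truthVec d M φ) (truthVec d M ψ)
  | .or φ ψ => combine (· || ·) M (truthVec d M φ) (truthVec d M ψ)
  | .mod h φ => modVec d M h (truthVec d M φ)

/-- The vector computed from the vectors of the immediate subformulas, which are on top of the
stack `st`. -/
def evalTop (d : OneStepConj Λ ℕ × Λ × PosProp ℕ → Bool) (M : List (RawNode Λ))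
    (st : List (List Bool)) : Formula Λ → List Bool
  | .top => M.map fun _ => true
  | .bot => M.map fun _ => false
  | .and _ _ => combine (· && ·) M (st.headD []) (st.tail.headD [])
  | .or _ _ => combine (· || ·) M (st.headD []) (st.tail.headD [])
  | .mod h _ => modVec d M h (st.headD [])

/-- The stack without the vectors that are consumed by the top operator of a formula. -/
def popArgs (st : List (List Bool)) : Formula Λ → List (List Bool)
  | .top => st
  | .bot => st
  | .and _ _ => st.tail.tail
  | .or _ _ => st.tail.tail
  | .mod _ _ => st.tail

/-- One step of the evaluation of a formula in postfix order on a stack of truth vectors. -/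
def evalStep (d : OneStepConj Λ ℕ × Λ × PosProp ℕ → Bool) (M : List (RawNode Λ))
    (st : List (List Bool)) (φ : Formula Λ) : List (List Bool) :=
  evalTop d M st φ :: popArgs st φ

/-- The immediate subformulas of a formula. -/
def Formula.children : Formula Λ → List (Formula Λ)
  | .top => []
  | .bot => []
  | .and φ ψ => [φ, ψ]
  | .or φ ψ => [φ, ψ]
  | .mod _ φ => [φ]

/-- All occurrences of subformulas, in prefix order. -/
def Formula.subs : Formula Λ → List (Formula Λ)
  | .top => [.top]
  | .bot => [.bot]
  | .and φ ψ => .and φ ψ :: (φ.subs ++ ψ.subs)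
  | .or φ ψ => .or φ ψ :: (φ.subs ++ ψ.subs)
  | .mod h φ => .mod h φ :: φ.subs

theorem Formula.subs_eq (φ : Formula Λ) : φ.subs = φ :: φ.children.flatMap Formula.subs := by
  cases φ <;> simp [subs, children]

/-- Evaluation in postfix order pushes the truth vector of the formula.  Reversed prefix order
evaluates the second argument first, so that the first one ends up on top. -/
theorem foldl_evalStep (d : OneStepConj Λ ℕ × Λ × PosProp ℕ → Bool) (M : List (RawNode Λ))
    (φ : Formula Λ) (st : List (List Bool)) :
    φ.subs.reverse.foldl (evalStep d M) st = truthVec d M φ :: st := by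
  induction φ generalizing st with
  | top => rfl
  | bot => rfl
  | and φ ψ ih₁ ih₂ | or φ ψ ih₁ ih₂ =>
    simp [Formula.subs, List.foldl_append, ih₁, ih₂, evalStep, evalTop, popArgs, truthVec,
      -List.foldl_reverse]
  | mod h φ ih =>
    simp [Formula.subs, List.foldl_append, ih, evalStep, evalTop, popArgs, truthVec,
      -List.foldl_reverse]

/-- The length does not depend on the stack, which bounds the growth of the stack. -/
theorem length_evalTop (d : OneStepConj Λ ℕ × Λ × PosProp ℕ → Bool) (M : List (RawNode Λ))
    (st : List (List Bool)) (φ : Formula Λ) : (evalTop d M st φ).length = M.length := by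
  cases φ <;> simp [evalTop, length_combine, modVec]

theorem size_popArgs_le (st : List (List Bool)) (φ : Formula Λ) :
    (encList encVec (popArgs st φ)).size ≤ (encList encVec st).size := by
  have h := fun st : List (List Bool) => encList_drop_size_le encVec st 1
  simp only [List.drop_one] at h
  cases φ
  · exact le_rfl
  · exact le_rfl
  · exact (h _).trans (h _)
  · exact (h _).trans (h _)
  · exact h _

/-- Correctness of the evaluation: the truth vector of a formula describes its extension in the
coalgebra of the abstract wsi model. -/
theorem Realization.getD_truthVec {T : Type u → Type u} [Functor T] {I : Interpretation T Λ}
    {A : AbstractModel Λ} {φ : Formula Λ} (R : Realization I A φ)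
    {d : OneStepConj Λ ℕ × Λ × PosProp ℕ → Bool}
    (hd : ∀ i, d i = true ↔ OneStepConsequence I i.1 i.2.1 i.2.2) (χ : Formula Λ)
    (s : Fin A.card) :
    (truthVec d A.raw χ).getD s false = true ↔ ULift.up s ∈ extension I (A.coalg R.t) χ := by
  have hs : s.val < A.raw.length := by simp [AbstractModel.raw]
  induction χ generalizing s with
  | top => simp [truthVec, extension, hs]
  | bot => simp [truthVec, extension, hs]
  | and φ ψ ih₁ ih₂ =>
    rw [truthVec, getD_combine _ hs, Bool.and_eq_true]
    exact and_congr (ih₁ s hs) (ih₂ s hs)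
  | or φ ψ ih₁ ih₂ =>
    rw [truthVec, getD_combine _ hs, Bool.or_eq_true]
    exact or_congr (ih₁ s hs) (ih₂ s hs)
  | mod h χ ih =>
    rw [R.mem_extension_mod_iff (fun s => ih s (by simp [AbstractModel.raw])) s h, ← hd (_, _, _),
      truthVec, modVec, List.getD_eq_getElem _ _ (by simpa using hs)]
    simp [AbstractModel.raw, AbstractNode.raw]

end Raw

/-! ### Recursion over formulas -/

section Formulas

variable {Λ : Type v} {code : Λ → Data}

/-- The number that marks the top operator of a formula in its encoding. -/
def Formula.tag : Formula Λ → ℕ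
  | .top => 0
  | .bot => 1
  | .and _ _ => 2
  | .or _ _ => 3
  | .mod _ _ => 4

theorem hd_encFormula (code : Λ → Data) (φ : Formula Λ) :
    (encFormula code φ).hd = encUnary φ.tag := by
  cases φ <;> rfl

/-- Case distinction on the top operator of a formula. -/
theorem PolyTime.formulaCases {ι : Type*} {e g : ι × Formula Λ → Data}
    (he : PolyTime e (fun x => encFormula code x.2))
    (h_top : PolyTime (fun i => e (i, .top)) (fun i => g (i, .top)))
    (h_bot : PolyTime (fun i => e (i, .bot)) (fun i => g (i, .bot)))
    (h_and : PolyTime (fun x : ι × Formula Λ × Formula Λ => e (x.1, .and x.2.1 x.2.2))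
      (fun x => g (x.1, .and x.2.1 x.2.2)))
    (h_or : PolyTime (fun x : ι × Formula Λ × Formula Λ => e (x.1, .or x.2.1 x.2.2))
      (fun x => g (x.1, .or x.2.1 x.2.2)))
    (h_mod : PolyTime (fun x : ι × Λ × Formula Λ => e (x.1, .mod x.2.1 x.2.2))
      (fun x => g (x.1, .mod x.2.1 x.2.2))) : PolyTime e g := by
  refine switch 5 (fun x => x.2.tag) (fun x => ?_)
    (he.hd.reindex fun x => ⟨x, rfl, (hd_encFormula code x.2).symm⟩) fun j hj => ?_
  · rcases x with ⟨i, _ | _ | _ | _ | _⟩ <;> simp [Formula.tag]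
  · interval_cases j
    · refine h_top.reindex fun ⟨⟨i, φ⟩, h⟩ => ?_
      cases φ with
      | top => exact ⟨i, rfl, rfl⟩
      | _ => simp [Formula.tag] at h
    · refine h_bot.reindex fun ⟨⟨i, φ⟩, h⟩ => ?_
      cases φ with
      | bot => exact ⟨i, rfl, rfl⟩
      | _ => simp [Formula.tag] at h
    · refine h_and.reindex fun ⟨⟨i, φ⟩, h⟩ => ?_
      cases φ with
      | and φ ψ => exact ⟨(i, φ, ψ), rfl, rfl⟩
      | _ => simp [Formula.tag] at h
    · refine h_or.reindex fun ⟨⟨i, φ⟩, h⟩ => ?_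
      cases φ with
      | or φ ψ => exact ⟨(i, φ, ψ), rfl, rfl⟩
      | _ => simp [Formula.tag] at h
    · refine h_mod.reindex fun ⟨⟨i, φ⟩, h⟩ => ?_
      cases φ with
      | mod a φ => exact ⟨(i, a, φ), rfl, rfl⟩
      | _ => simp [Formula.tag] at h

theorem Formula.self_mem_subs (φ : Formula Λ) : φ ∈ φ.subs := by
  rw [subs_eq]
  exact List.mem_cons_self

theorem Formula.length_subs_le (code : Λ → Data) (φ : Formula Λ) :
    φ.subs.length ≤ (encFormula code φ).size := by
  induction φ <;> simp only [subs, encFormula, Data.size, List.length_cons, List.length_append,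
    List.length_nil] <;> omega

theorem Formula.size_le_of_mem_subs {φ χ : Formula Λ} (h : χ ∈ φ.subs) :
    (encFormula code χ).size ≤ (encFormula code φ).size := by
  induction φ with
  | top | bot => rw [List.mem_singleton.1 h]
  | and φ ψ ih₁ ih₂ | or φ ψ ih₁ ih₂ =>
    rcases List.mem_cons.1 h with rfl | h
    · exact le_rfl
    · simp only [encFormula, Data.size]
      rcases List.mem_append.1 h with h | h
      · have := ih₁ h
        omega
      · have := ih₂ h
        omega
  | mod _ φ ih =>
    rcases List.mem_cons.1 h with rfl | h
    · exact le_rfl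
    · have := ih h
      simp only [encFormula, Data.size]
      omega

/-- One step of the depth-first traversal of formulas: the first formula of the agenda is replaced
by its immediate subformulas and recorded in the output. -/
def visit (W : List (Formula Λ) × List (Formula Λ)) : List (Formula Λ) × List (Formula Λ) :=
  match W with
  | ([], out) => ([], out)
  | (φ :: W, out) => (φ.children ++ W, φ :: out)

/-- The invariant of the traversal: the output, followed by the subformulas of the agenda, lists
the subformulas of `ψ`.  As each step outputs one formula, the agenda is empty exactly after
`ψ.subs.length` steps. -/
theorem visit_iterate_spec (ψ : Formula Λ) {k : ℕ} (hk : k ≤ ψ.subs.length) :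
    (visit^[k] ([ψ], [])).2.reverse ++ (visit^[k] ([ψ], [])).1.flatMap Formula.subs = ψ.subs ∧
      (visit^[k] ([ψ], [])).2.length = k := by
  induction k with
  | zero => simp
  | succ k ih =>
    obtain ⟨h₁, h₂⟩ := ih (by omega)
    rw [Function.iterate_succ_apply']
    rcases h : visit^[k] ([ψ], []) with ⟨_ | ⟨φ, W⟩, out⟩
    · rw [h] at h₁ h₂
      have := congrArg List.length h₁
      simp at this h₂
      omega
    · rw [h] at h₁ h₂
      constructor
      · rw [← h₁]
        simp [visit, Formula.subs_eq φ]
      · simpa [visit] using h₂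

theorem length_le_length_flatMap_subs (W : List (Formula Λ)) :
    W.length ≤ (W.flatMap Formula.subs).length := by
  induction W with
  | nil => simp
  | cons φ W ih =>
    rw [List.flatMap_cons, Formula.subs_eq]
    simp only [List.cons_append, List.length_cons, List.length_append]
    omega

/-- The encoding of the states of the traversal. -/
def encAgenda (code : Λ → Data) (W : List (Formula Λ) × List (Formula Λ)) : Data :=
  .cons (encList (encFormula code) W.1) (encList (encFormula code) W.2)

/-- Agenda and output consist of subformulas of `ψ` and are no longer than `ψ.subs`, hence of
quadratic size. -/
theorem size_encAgenda_visit_le (ψ : Formula Λ) {k : ℕ} (hk : k ≤ ψ.subs.length) :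
    (encAgenda code (visit^[k] ([ψ], []))).size ≤
      2 * ((encFormula code ψ).size * ((encFormula code ψ).size + 1)) + 3 := by
  obtain ⟨h₁, h₂⟩ := visit_iterate_spec ψ hk
  generalize visit^[k] ([ψ], []) = S at h₁ h₂
  have hψ := ψ.length_subs_le code
  have hlen := congrArg List.length h₁
  rw [List.length_append, List.length_reverse] at hlen
  have hW := length_le_length_flatMap_subs S.1
  have bound : ∀ l : List (Formula Λ), (∀ χ ∈ l, χ ∈ ψ.subs) → l.length ≤ ψ.subs.length →
      (encList (encFormula code) l).size ≤
        (encFormula code ψ).size * ((encFormula code ψ).size + 1) + 1 := by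
    intro l hl hlen
    refine (encList_size_le fun χ hχ => Formula.size_le_of_mem_subs (hl χ hχ)).trans ?_
    exact Nat.add_le_add_right (Nat.mul_le_mul_right _ (hlen.trans hψ)) 1
  have b₁ := bound S.1 (fun χ hχ => by
    rw [← h₁]
    exact List.mem_append_right _ (List.mem_flatMap.2 ⟨χ, hχ, χ.self_mem_subs⟩)) (by omega)
  have b₂ := bound S.2 (fun χ hχ => by
    rw [← h₁]
    exact List.mem_append_left _ (List.mem_reverse.2 hχ)) (by omega)
  simp only [encAgenda, Data.size]
  omega

/-- The index is an agenda with its first formula split off, since the traversal stops at an empty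
agenda. -/
theorem PolyTime.visit : PolyTime
    (fun x : (List (Formula Λ) × List (Formula Λ)) × Formula Λ =>
      encAgenda code (x.2 :: x.1.1, x.1.2))
    (fun x => encAgenda code (visit (x.2 :: x.1.1, x.1.2))) := by
  have hx := refl (fun x : (List (Formula Λ) × List (Formula Λ)) × Formula Λ =>
      encAgenda code (x.2 :: x.1.1, x.1.2))
  have hφ := hx.hd.hd
  have hW := hx.hd.tl
  have hout := hφ.cons hx.tl
  refine formulaCases (code := code) hφ ?_ ?_ ?_ ?_ ?_
  · exact (hW.cons hout).comap fun i => (i, .top)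
  · exact (hW.cons hout).comap fun i => (i, .bot)
  · exact ((hφ.tl.hd.cons (hφ.tl.tl.cons hW)).cons hout).comap
      fun x : (List (Formula Λ) × List (Formula Λ)) × Formula Λ × Formula Λ =>
        (x.1, .and x.2.1 x.2.2)
  · exact ((hφ.tl.hd.cons (hφ.tl.tl.cons hW)).cons hout).comap
      fun x : (List (Formula Λ) × List (Formula Λ)) × Formula Λ × Formula Λ =>
        (x.1, .or x.2.1 x.2.2)
  · exact ((hφ.tl.tl.cons hW).cons hout).comap
      fun x : (List (Formula Λ) × List (Formula Λ)) × Λ × Formula Λ => (x.1, .mod x.2.1 x.2.2)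

/-- The list of all subformulas, in postfix order up to the order of arguments, is computable in
polynomial time. -/
theorem PolyTime.reverse_subs {ι : Type*} {e : ι → Data} {ψ : ι → Formula Λ}
    (hψ : PolyTime e (fun i => encFormula code (ψ i))) :
    PolyTime e (fun i => encList (encFormula code) (ψ i).subs.reverse) := by
  let S : ι → ℕ → Data := fun i k => encAgenda code (CoalgLogic.visit^[k] ([ψ i], []))
  have start : PolyTime e (fun i => S i 0) := (hψ.cons (const e .nil)).cons (const e .nil)
  have agenda_nil : ∀ i, (CoalgLogic.visit^[(ψ i).subs.length] ([ψ i], [])).1 = [] := by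
    intro i
    obtain ⟨h₁, h₂⟩ := visit_iterate_spec (ψ i) le_rfl
    have hlen := congrArg List.length h₁
    rw [List.length_append, List.length_reverse, h₂] at hlen
    have := length_le_length_flatMap_subs (CoalgLogic.visit^[(ψ i).subs.length] ([ψ i], [])).1
    exact List.length_eq_zero_iff.1 (by omega)
  have agenda_cons : ∀ i, ∀ k < (ψ i).subs.length, ∃ φ W out,
      CoalgLogic.visit^[k] ([ψ i], []) = (φ :: W, out) := by
    intro i k hk
    obtain ⟨h₁, h₂⟩ := visit_iterate_spec (ψ i) hk.le
    rcases h : CoalgLogic.visit^[k] ([ψ i], []) with ⟨_ | ⟨φ, W⟩, out⟩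
    · rw [h] at h₁ h₂
      have := congrArg List.length h₁
      simp at this h₂
      omega
    · exact ⟨φ, W, out, rfl⟩
  have main : PolyTime (fun i => S i 0) (fun i => S i (ψ i).subs.length) := by
    refine loop (c := Data.hd) (refl _).hd ?_ ?_ ?_ Polynomial.X
      (2 * (Polynomial.X * (Polynomial.X + 1)) + 3) ?_ ?_
    · intro i
      simp [S, encAgenda, Data.hd, agenda_nil, encList]
    · intro i k hk
      obtain ⟨φ, W, out, h⟩ := agenda_cons i k hk
      simp [S, encAgenda, Data.hd, h, encList]
    · refine (PolyTime.visit (code := code)).reindex fun ⟨⟨i, k⟩, hk⟩ => ?_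
      obtain ⟨φ, W, out, h⟩ := agenda_cons i k hk
      refine ⟨((W, out), φ), ?_, ?_⟩
      · simp only [S, h]
      · simp only [S, Function.iterate_succ_apply', h]
    · intro i
      have := (ψ i).length_subs_le code
      simp only [S, encAgenda, Function.iterate_zero, id, encList, Data.size, Polynomial.eval_X]
      omega
    · intro i k hk
      have h := size_encAgenda_visit_le (code := code) (ψ i) hk
      have hs : (encFormula code (ψ i)).size ≤ (S i 0).size := by
        simp only [S, encAgenda, Function.iterate_zero, id, encList, Data.size]
        omega
      have := Nat.mul_le_mul hs (Nat.add_le_add_right hs 1)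
      simp only [Polynomial.eval_add, Polynomial.eval_mul, Polynomial.eval_X, Polynomial.eval_one,
        Polynomial.eval_ofNat]
      exact h.trans (by omega)
  refine (start.trans main).tl.reindex fun i => ⟨i, rfl, ?_⟩
  have h := (visit_iterate_spec (ψ i) le_rfl).1
  rw [agenda_nil i, List.flatMap_nil, List.append_nil] at h
  simp only [S, encAgenda, Data.tl]
  rw [← List.reverse_reverse (CoalgLogic.visit^[_] _).2, h]

/-! ### Polynomial-time evaluation -/

variable {d : OneStepConj Λ ℕ × Λ × PosProp ℕ → Bool}

/-- `d` is computable in polynomial time on encoded instances `(ψ, ♥, ρ)` of the one-step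
consequence problem. -/
abbrev OneStepPolyTime (code : Λ → Data) (d : OneStepConj Λ ℕ × Λ × PosProp ℕ → Bool) : Prop :=
  PolyTime (fun i : OneStepConj Λ ℕ × Λ × PosProp ℕ =>
    Data.cons (encOneStepConj code i.1) (Data.cons (code i.2.1) (encPosProp i.2.2)))
    (fun i => encBool (d i))

theorem PolyTime.modVec (hd : OneStepPolyTime code d) {ι : Type*} {e : ι → Data}
    {M : ι → List (RawNode Λ)} {h : ι → Λ} {v : ι → List Bool}
    (hM : PolyTime e (fun i => encList (encRawNode code) (M i)))
    (hh : PolyTime e (fun i => code (h i))) (hv : PolyTime e (fun i => encVec (v i))) :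
    PolyTime e (fun i => encVec (modVec d (M i) (h i) (v i))) := by
  have hx := refl (fun x : ι × RawNode Λ =>
    Data.cons (.cons (code (h x.1)) (encVec (v x.1))) (encRawNode code x.2))
  have hdisj := PolyTime.disjMarked hx.hd.tl hx.tl.tl
  exact map (f := fun i N => d (N.1, h i, CoalgLogic.disjMarked (v i) N.2))
    ((hx.tl.hd.cons (hx.hd.hd.cons hdisj)).trans
      (hd.comap fun x : ι × RawNode Λ => (x.2.1, h x.1, CoalgLogic.disjMarked (v x.1) x.2.2)))
    (hh.cons hv) hM

theorem PolyTime.evalStep (hd : OneStepPolyTime code d) :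
    PolyTime (fun x : List (RawNode Λ) × List (List Bool) × Formula Λ =>
        .cons (encList (encRawNode code) x.1)
          (.cons (encList encVec x.2.1) (encFormula code x.2.2)))
      (fun x => encList encVec (evalStep d x.1 x.2.1 x.2.2)) := by
  let e : (List (RawNode Λ) × List (List Bool)) × Formula Λ → Data := fun x =>
    .cons (encList (encRawNode code) x.1.1)
      (.cons (encList encVec x.1.2) (encFormula code x.2))
  have hx := refl e
  have hM : PolyTime e (fun x => encList (encRawNode code) x.1.1) := hx.hd
  have hst : PolyTime e (fun x => encList encVec x.1.2) := hx.tl.hd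
  have hst₁ : PolyTime e (fun x => encList encVec x.1.2.tail) :=
    hst.tl.reindex fun x => ⟨x, rfl, encList_tail _ _⟩
  have hst₂ : PolyTime e (fun x => encList encVec x.1.2.tail.tail) :=
    hst₁.tl.reindex fun x => ⟨x, rfl, encList_tail _ _⟩
  have hv : PolyTime e (fun x => encVec (x.1.2.headD [])) :=
    hst.hd.reindex fun x => ⟨x, rfl, encList_headD_nil _ _⟩
  have hw : PolyTime e (fun x => encVec (x.1.2.tail.headD [])) :=
    hst₁.hd.reindex fun x => ⟨x, rfl, encList_headD_nil _ _⟩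
  have hconst : ∀ b : Bool, PolyTime e (fun x => encVec (x.1.1.map fun _ => b)) := fun b =>
    map (f := fun _ _ => b) (env := fun _ => .nil) (const _ (encBool b)) (const _ .nil) hM
  suffices H : PolyTime e (fun x => encList encVec (CoalgLogic.evalStep d x.1.1 x.1.2 x.2)) from
    H.reindex fun x => ⟨((x.1, x.2.1), x.2.2), rfl, rfl⟩
  refine formulaCases (code := code) hx.tl.tl ?_ ?_ ?_ ?_ ?_
  · exact ((hconst true).cons hst).comap fun i => (i, .top)
  · exact ((hconst false).cons hst).comap fun i => (i, .bot)
  · exact ((PolyTime.combine (· && ·) hM hv hw).cons hst₂).comap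
      fun x : (List (RawNode Λ) × List (List Bool)) × Formula Λ × Formula Λ =>
        (x.1, .and x.2.1 x.2.2)
  · exact ((PolyTime.combine (· || ·) hM hv hw).cons hst₂).comap
      fun x : (List (RawNode Λ) × List (List Bool)) × Formula Λ × Formula Λ =>
        (x.1, .or x.2.1 x.2.2)
  · let k : (List (RawNode Λ) × List (List Bool)) × Λ × Formula Λ →
        (List (RawNode Λ) × List (List Bool)) × Formula Λ := fun x => (x.1, .mod x.2.1 x.2.2)
    exact (PolyTime.modVec hd (hM.comap k) (hx.comap k).tl.tl.tl.hd (hv.comap k)).cons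
      (hst₁.comap k)

/-- Truth vectors are computable in polynomial time. -/
theorem PolyTime.truthVec (hd : OneStepPolyTime code d) {ι : Type*} {e : ι → Data}
    {M : ι → List (RawNode Λ)} {ψ : ι → Formula Λ}
    (hM : PolyTime e (fun i => encList (encRawNode code) (M i)))
    (hψ : PolyTime e (fun i => encFormula code (ψ i))) :
    PolyTime e (fun i => encVec (truthVec d (M i) (ψ i))) := by
  have := foldl (f := fun i st φ => CoalgLogic.evalStep d (M i) st φ) (c := fun _ => [])
    (eγ := encList encVec)
    ((PolyTime.evalStep hd).comap fun x : ι × List (List Bool) × Formula Λ => (M x.1, x.2))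
    (4 * Polynomial.X + 2) (fun i st φ => ?_) hM hψ.reverse_subs (const e .nil)
  · refine this.hd.reindex fun i => ⟨i, rfl, ?_⟩
    rw [foldl_evalStep]
    rfl
  · have h₁ := size_encVec_le (evalTop d (M i) st φ)
    have h₂ := size_popArgs_le st φ
    have h₃ := length_lt_encList_size (encRawNode code) (M i)
    rw [length_evalTop] at h₁
    simp only [CoalgLogic.evalStep, encList, Data.size, Polynomial.eval_add, Polynomial.eval_mul,
      Polynomial.eval_X, Polynomial.eval_ofNat]
    simp only [encVec] at *
    omega

end Formulas

end CoalgLogic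

theorem mainTheorem9 {T : Type u → Type u} [Functor T] [LawfulFunctor T] {Λ : Type v}
    (I : CoalgLogic.Interpretation T Λ)
    (code : Λ → CoalgLogic.Data) (hcode : Function.Injective code)
    (L : Set (CoalgLogic.Formula Λ)) (hL : ∀ φ ∈ L, φ.IsConjunctive)
    (hmodels : CoalgLogic.AdmitsPolynomialWsiModels I code L)
    (hconseq : CoalgLogic.OneStepConsequenceInP I code) :
    CoalgLogic.SubsumptionInP I code L := by
  open CoalgLogic in
  obtain ⟨F, hF, hFP⟩ := hmodels
  obtain ⟨d, hd, hdP⟩ := hconseq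
  refine ⟨fun i => (truthVec d (F i.1).raw i.2).getD (F i.1).root false, fun i => ?_, ?_⟩
  · obtain ⟨R⟩ := (hF i.1).nonempty_realization
    exact (R.getD_truthVec hd i.2 _).trans (R.subsumes_iff (hL _ i.1.2) i.2).symm
  · let e : L × Formula Λ → Data := fun i => .cons (encFormula code i.1) (encFormula code i.2)
    have hF' : PolyTime (fun φ : L => encFormula code φ)
        (fun φ => .cons (encUnary (F φ).root) (encList (encRawNode code) (F φ).raw)) :=
      PolyTime.reindex hFP fun φ => ⟨φ, rfl, (encModel_eq code (F φ)).symm⟩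
    have hA := (PolyTime.refl e).hd.trans (hF'.comap Prod.fst)
    exact (PolyTime.truthVec hdP hA.tl (PolyTime.refl e).tl).getD hA.hd
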